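/- Let $\gamma>2$ and let $\mathbf U:\mathbb T^2\to[0,\infty)$ be either $(\mathcal A_1)$ $\mathbf U(x_1,x_2)=(2-\sin 2\pi x_1-\sin 2\pi x_2)^\gamma$ or $(\mathcal A_2)$ $\mathbf U(x_1,x_2)=(2-\cos 2\pi x_1-\cos 2\pi x_2)^\gamma$. Let $\xi\in\mathbb R^2$ have a Diophantine index $\sigma<2$ (for example $\sigma=1$): $\sigma>0$ and there is $c>0$ with $|\xi\cdot\kappa|\ge c|\kappa|^{-\sigma}$ for all $\kappa\in\mathbb Z^2\setminus\{0\}$. Put $H(x,p)=\frac12|p|^2-\mathbf U(\xi x)$ for $x,p\in\mathbb R$, let $L(x,v)=\sup_{p\in\mathbb R}(pv-H(x,p))$, and let $\overline H(p)$ be the effective Hamiltonian, i.e. the constant $c$ such that for every $\delta>0$ some bounded Lipschitz $w:\mathbb R\to\mathbb R$ satisfies $c-\delta\le H(x,p+w'(x))\le c+\delta$ on $\mathbb R$ in the viscosity sense. Let $p_0=\int_{\mathbb T^2}(2\mathbf U(\mathbf x))^{1/2}\,d\mathbf x$. A characteristic associated with $p$ is a locally absolutely continuous curve $\eta:[0,\infty)\to\mathbb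 R$ such that, for some exact sublinear corrector $v$ at $p$ (that is, $v\in C^1(\mathbb R)$ with $H(x,p+v'(x))=\overline H(p)$ for all $x\in\mathbb R$ and $v(x)/x\to0$ as $|x|\to\infty$), the function $s\mapsto L(\eta(s),\dot\eta(s))+\overline H(p)$ is integrable on $[a,b]$ and $$\int_a^b\big(L(\eta(s),\dot\eta(s))+\overline H(p)\big)\,ds=p\,\eta(b)-p\,\eta(a)+v(\eta(b))-v(\eta(a))\qquad\text{for all }0\le a\le b.$$ Let $$\tau=\frac{(\gamma-2)(3\gamma-2)}{(\gamma-2)(3\gamma-2)+4\gamma^2}.$$ Then $\tau>\frac{\gamma-2}{3\gamma-2}$, and there is a constant $C>0$, depending only on $\mathbf U$ and $\xi$, such that every characteristic $\eta_0$ associated with $p=p_0$ satisfies $$\left|\frac{\eta_0(t)}{t}\right|\le C\,t^{-\tau}\quad\text{for all }t>0,\ \text{if }\eta_0(0)=0,$$ and, whatever its starting point, $$\left|\frac{\eta_0(t)}{t}\right|\le (C+|\eta_0(0)|)\,t^{-\tau}\quad\text{for all }t\ge1.$$ -/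

import Mathlib

open Filter Topology MeasureTheory

noncomputable section

namespace QPHomog

/-- The pair `(ξ₁, ξ₂)` has Diophantine index `σ`: `|ξ · κ| ≥ c |κ|^(-σ)` for some `c > 0` and all
nonzero `κ = (k, l) ∈ ℤ²`, with `|κ|` the Euclidean norm. In particular `(ξ₁, ξ₂)` is
non-resonant. -/
def HasDiophantineIndex (ξ₁ ξ₂ σ : ℝ) : Prop :=
  0 < σ ∧ ∃ c : ℝ, 0 < c ∧ ∀ k l : ℤ, (k, l) ≠ (0, 0) →
    c * Real.sqrt ((k : ℝ) ^ 2 + (l : ℝ) ^ 2) ^ (-σ) ≤ |ξ₁ * k + ξ₂ * l|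

/-- The first prototype suspension, as a function on `ℝ²` that is 1-periodic in each variable. -/
def sinPotential (γ : ℝ) (x y : ℝ) : ℝ :=
  (2 - Real.sin (2 * Real.pi * x) - Real.sin (2 * Real.pi * y)) ^ γ

/-- The second prototype suspension, as a function on `ℝ²` that is 1-periodic in each variable. -/
def cosPotential (γ : ℝ) (x y : ℝ) : ℝ :=
  (2 - Real.cos (2 * Real.pi * x) - Real.cos (2 * Real.pi * y)) ^ γ

/-- The mechanical Hamiltonian `H(x, p) = |p|² / 2 + V(x)` with `V(x) = -U(ξ x)`. -/
def mechHamiltonian (U : ℝ → ℝ → ℝ) (ξ₁ ξ₂ : ℝ) (x p : ℝ) : ℝ :=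
  |p| ^ 2 / 2 + -U (ξ₁ * x) (ξ₂ * x)

/-- `w` satisfies `H(x, p + w'(x)) ≤ c` on `ℝ` in the viscosity sense. -/
def IsViscositySub (H : ℝ → ℝ → ℝ) (p c : ℝ) (w : ℝ → ℝ) : Prop :=
  ∀ φ : ℝ → ℝ, ContDiff ℝ 1 φ → ∀ x : ℝ, IsLocalMax (fun y => w y - φ y) x →
    H x (p + deriv φ x) ≤ c

/-- `w` satisfies `c ≤ H(x, p + w'(x))` on `ℝ` in the viscosity sense. -/
def IsViscositySuper (H : ℝ → ℝ → ℝ) (p c : ℝ) (w : ℝ → ℝ) : Prop :=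
  ∀ φ : ℝ → ℝ, ContDiff ℝ 1 φ → ∀ x : ℝ, IsLocalMin (fun y => w y - φ y) x →
    c ≤ H x (p + deriv φ x)

/-- `w` is an approximate corrector at `p` for the value `c` with error `δ`: it is bounded and
Lipschitz and solves `c - δ ≤ H(x, p + w') ≤ c + δ` in the viscosity sense. -/
def IsApproxCorrector (H : ℝ → ℝ → ℝ) (p c δ : ℝ) (w : ℝ → ℝ) : Prop :=
  (∃ M : ℝ, ∀ x, |w x| ≤ M) ∧ (∃ K : NNReal, LipschitzWith K w) ∧
    IsViscositySuper H p (c - δ) w ∧ IsViscositySub H p (c + δ) w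

/-- The effective Hamiltonian: `effHamiltonian H p` is the constant `c` such that approximate
correctors at `p` for `c` exist for every error `δ > 0`. -/
def effHamiltonian (H : ℝ → ℝ → ℝ) (p : ℝ) : ℝ :=
  Classical.epsilon fun c : ℝ => ∀ δ : ℝ, 0 < δ → ∃ w : ℝ → ℝ, IsApproxCorrector H p c δ w

/-- The critical momentum `p₀`, the integral of `(2U)^(1/2)` over the torus. -/
def criticalMomentum (U : ℝ → ℝ → ℝ) : ℝ :=
  ∫ x in (0 : ℝ)..1, ∫ y in (0 : ℝ)..1, Real.sqrt (2 * U x y)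

/-- The Lagrangian, i.e. the Legendre transform of `H` in its second argument. -/
def lagrangian (H : ℝ → ℝ → ℝ) (x v : ℝ) : ℝ :=
  ⨆ p : ℝ, (p * v - H x p)

/-- `v` is an exact sublinear corrector at `p`: a classical solution of class `C¹` of
`H(x, p + v'(x)) = effHamiltonian H p` on `ℝ` with `v(x) / x → 0` as `|x| → ∞`. -/
def IsExactCorrector (H : ℝ → ℝ → ℝ) (p : ℝ) (v : ℝ → ℝ) : Prop :=
  ContDiff ℝ 1 v ∧ (∀ x : ℝ, H x (p + deriv v x) = effHamiltonian H p) ∧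
    Tendsto (fun x => v x / x) (cocompact ℝ) (𝓝 0)

/-- `η` (restricted to `[0, ∞)`) is a characteristic (calibrated curve) associated with `p`: it is
locally absolutely continuous, and for some exact corrector `v` at `p` the calibration identity
holds on every `[a, b] ⊆ [0, ∞)`, the action being a convergent integral. -/
def IsCharacteristic (H : ℝ → ℝ → ℝ) (p : ℝ) (η : ℝ → ℝ) : Prop :=
  ∃ v : ℝ → ℝ, IsExactCorrector H p v ∧
    ∀ a b : ℝ, 0 ≤ a → a ≤ b →
      AbsolutelyContinuousOnInterval η a b ∧
      IntervalIntegrable (fun s => lagrangian H (η s) (deriv η s) + effHamiltonian H p) volume a b ∧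
      ∫ s in a..b, (lagrangian H (η s) (deriv η s) + effHamiltonian H p) =
        p * η b - p * η a + v (η b) - v (η a)

/-- The improved exponent. -/
def improvedRate (γ : ℝ) : ℝ :=
  (γ - 2) * (3 * γ - 2) / ((γ - 2) * (3 * γ - 2) + 4 * γ ^ 2)

end QPHomog

end

/-! At the critical momentum the effective Hamiltonian is at most zero, so equality in Young's
inequality along a calibrated curve forces speed at most √(2U). The displacement is then controlled
by how much time a curve of that speed must lose near the zeros of U. The sign comes from Fourier
analysis: √(2U) − p₀ has mean zero, hence along a nonresonant line it is a uniform limit of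
trigonometric polynomials with bounded primitives. Those primitives are approximate correctors for
the value 0, and a penalized comparison excludes positive values (`effHamiltonian_nonpos`). For the
time, parametrize the line as (u, αu) with α = ξ₂/ξ₁. If q is the denominator of a Dirichlet
approximation of α, every u-window of length q meets a 1/q-neighbourhood of a lattice zero and stays
there for length 1/q. There √(2U) ≲ q^(-γ), which costs time of order q^(γ-1). A displacement of
order N contains about N/q windows, hence costs N q^(γ-2). Dirichlet at level N together with σ < 2
gives q² ≳ N, so the cost is at least of order N^(γ/2) (`exists_rpow_le_integral_inv`). Therefore
the displacement is O(t^(2/γ)) for large t, and 2/γ ≤ 1 − τ. -/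

namespace QPHomog

/-! ### Rational approximation of the slope -/

/-- Every window of `r.den` consecutive integers contains some `k` for which `θ + α k` is within
`2 / r.den` of an integer, when `r` is a good rational approximation of `α`. -/
lemma exists_int_mem_window_near_int {α : ℝ} {r : ℚ} (hr : |α - r| ≤ 1 / (r.den : ℝ) ^ 2)
    (θ : ℝ) (a : ℤ) :
    ∃ k n : ℤ, a ≤ k ∧ k < a + r.den ∧ |θ + α * k - n| ≤ 2 / r.den := by
  obtain ⟨q, hqdef⟩ : ∃ q : ℤ, q = (r.den : ℤ) := ⟨_, rfl⟩
  have hq : 0 < q := by rw [hqdef]; exact_mod_cast r.den_pos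
  have hqR : (0 : ℝ) < q := by exact_mod_cast hq
  have hdq : (r.den : ℝ) = q := by simp [hqdef]
  rw [hdq] at hr ⊢
  rw [← hqdef]
  have hrq : (r : ℝ) * q = r.num := by
    rw [← hdq]; exact_mod_cast Rat.mul_den_eq_num r
  obtain ⟨u, v, huv⟩ : IsCoprime r.num q := by
    rw [hqdef, Int.isCoprime_iff_gcd_eq_one]
    exact r.reduced
  set θ' : ℝ := θ + α * a
  -- The fraction -m/q is the one nearest to θ'. Bézout makes u inverse to the numerator modulo q,
  -- so j steps of the rational rotation move by m/q modulo 1; replacing r by α costs at most j/q² ≤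
  -- 1/q.
  set m : ℤ := round (-(θ' * q))
  set j : ℤ := (m * u) % q
  have hj0 : 0 ≤ j := Int.emod_nonneg _ hq.ne'
  have hjq : j < q := Int.emod_lt_of_pos _ hq
  have hdvd : q ∣ j * r.num - m := by
    have h1 : j = m * u - q * (m * u / q) := by
      have := Int.emod_add_mul_ediv (m * u) q
      simp only [j]; linarith
    refine ⟨-(m * v) - (m * u / q) * r.num, ?_⟩
    rw [h1]
    linear_combination m * huv
  obtain ⟨n, hn⟩ := hdvd
  refine ⟨a + j, n, by linarith, by linarith, ?_⟩
  have hnR : (j : ℝ) * r.num - m = q * n := by exact_mod_cast hn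
  have e : θ + α * ((a + j : ℤ) : ℝ) - n = (θ' * q + m) / q + j * (α - r) := by
    have : (n : ℝ) = (j * r.num - m) / q := by field_simp; linarith
    rw [this, ← hrq]
    push_cast
    simp only [θ']
    field_simp
    ring
  have h1 : |(θ' * q + m) / q| ≤ 1 / q := by
    rw [abs_div, abs_of_pos hqR]
    gcongr
    have := abs_sub_round (-(θ' * q))
    rw [abs_sub_comm, sub_neg_eq_add, add_comm] at this
    linarith
  have h2 : |j * (α - r)| ≤ 1 / q := by
    rw [abs_mul, abs_of_nonneg (by exact_mod_cast hj0)]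
    calc (j : ℝ) * |α - r| ≤ q * (1 / (q : ℝ) ^ 2) := by
          gcongr
      _ = 1 / q := by field_simp
  rw [e]
  exact (abs_add_le _ _).trans ((add_le_add h1 h2).trans_eq (by ring))

/-- Nonresonance is all that the Fourier part needs; the quantitative condition serves only the
denominator bound. -/
lemma HasDiophantineIndex.eq_zero_of_resonance {ξ₁ ξ₂ σ : ℝ} (h : HasDiophantineIndex ξ₁ ξ₂ σ)
    {k l : ℤ} (hkl : ξ₁ * k + ξ₂ * l = 0) : k = 0 ∧ l = 0 := by
  obtain ⟨-, c, hc, h⟩ := h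
  by_contra hne
  have hne' : (k, l) ≠ (0, 0) := by simpa [Prod.ext_iff] using hne
  have h1 := h k l hne'
  rw [hkl, abs_zero] at h1
  have : 0 < (k : ℝ) ^ 2 + (l : ℝ) ^ 2 := by
    by_cases hk : k = 0
    · have : (l : ℝ) ≠ 0 := by exact_mod_cast fun hl => hne ⟨hk, hl⟩
      positivity
    · have : (k : ℝ) ≠ 0 := by exact_mod_cast hk
      positivity
  have : 0 < c * Real.sqrt ((k : ℝ) ^ 2 + (l : ℝ) ^ 2) ^ (-σ) := by positivity
  linarith

lemma HasDiophantineIndex.fst_ne_zero {ξ₁ ξ₂ σ : ℝ} (h : HasDiophantineIndex ξ₁ ξ₂ σ) :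
    ξ₁ ≠ 0 := fun h0 => by
  have := (h.eq_zero_of_resonance (k := 1) (l := 0) (by simp [h0])).1
  omega

/-- Dirichlet's approximations of the slope have denominators at least of the order of the square
root of the quality of approximation when the Diophantine index is less than `2`. -/
lemma HasDiophantineIndex.exists_rat_den_sq_ge {ξ₁ ξ₂ σ : ℝ} (h : HasDiophantineIndex ξ₁ ξ₂ σ)
    (hσ : σ < 2) : ∃ c : ℝ, 0 < c ∧ ∀ N : ℕ, 0 < N → ∃ r : ℚ,
      |ξ₂ / ξ₁ - r| ≤ 1 / (r.den : ℝ) ^ 2 ∧ r.den ≤ N ∧ c * N ≤ (r.den : ℝ) ^ 2 := by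
  have hξ := h.fst_ne_zero
  have hξ' : 0 < |ξ₁| := abs_pos.2 hξ
  obtain ⟨hσ0, c, hc, h⟩ := h
  set α := ξ₂ / ξ₁
  set B : ℝ := (|α| + 1) ^ 2 + 1
  have hB : 0 < B := by positivity
  refine ⟨c / (|ξ₁| * B), by positivity, fun N hN => ?_⟩
  obtain ⟨r, hr, hrN⟩ := Real.exists_rat_abs_sub_le_and_den_le α hN
  have hq : (0 : ℝ) < r.den := by exact_mod_cast r.den_pos
  have hq1 : (1 : ℝ) ≤ r.den := by exact_mod_cast r.den_pos
  have hN1 : (0 : ℝ) < N := by exact_mod_cast hN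
  have hrN' : (r.den : ℝ) ≤ N := by exact_mod_cast hrN
  have hrq : (r : ℝ) * r.den = r.num := by exact_mod_cast Rat.mul_den_eq_num r
  have hr2 : |α - r| ≤ 1 / (r.den : ℝ) ^ 2 := hr.trans (by
    gcongr
    nlinarith)
  refine ⟨r, hr2, hrN, ?_⟩
  have hkl : ((-r.num, (r.den : ℤ)) : ℤ × ℤ) ≠ (0, 0) := by
    simp [Prod.ext_iff]
  have h1 := h (-r.num) r.den hkl
  push_cast at h1
  have h2 : |ξ₁ * -(r.num : ℝ) + ξ₂ * r.den| ≤ |ξ₁| / N := by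
    have : ξ₁ * -(r.num : ℝ) + ξ₂ * r.den = ξ₁ * r.den * (α - r) := by
      rw [← hrq]; simp only [α]; field_simp; ring
    rw [this, abs_mul, abs_mul, abs_of_pos hq]
    calc |ξ₁| * r.den * |α - r| ≤ |ξ₁| * r.den * (1 / ((N + 1) * r.den)) := by gcongr
      _ = |ξ₁| / (N + 1) := by field_simp
      _ ≤ |ξ₁| / N := by gcongr; linarith
  set S := Real.sqrt ((-(r.num : ℝ)) ^ 2 + (r.den : ℝ) ^ 2)
  have hS1 : 1 ≤ S := by
    rw [Real.one_le_sqrt]; nlinarith [sq_nonneg (-(r.num : ℝ))]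
  -- This is where σ < 2 enters: the Diophantine and Dirichlet bounds together give N ≲ S^σ, and S
  -- is comparable to q.
  have hS : S ^ σ ≤ S ^ 2 := by
    rw [← Real.rpow_natCast]
    exact Real.rpow_le_rpow_of_exponent_le hS1 (by push_cast; exact hσ.le)
  have hS2 : S ^ 2 ≤ B * (r.den : ℝ) ^ 2 := by
    rw [Real.sq_sqrt (by positivity)]
    have h3 : |(r.num : ℝ)| ≤ (|α| + 1) * r.den := by
      rw [← hrq, abs_mul, abs_of_pos hq]
      gcongr
      have h4 : |α - r| ≤ 1 := hr2.trans (by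
        rw [div_le_one (by positivity)]; nlinarith)
      have := abs_sub_abs_le_abs_sub (r : ℝ) α
      rw [abs_sub_comm] at this
      linarith
    have h5 := pow_le_pow_left₀ (abs_nonneg _) h3 2
    rw [sq_abs, mul_pow] at h5
    simp only [B, neg_sq]
    linarith
  have hSp : 0 < S ^ σ := by positivity
  rw [Real.rpow_neg (by positivity)] at h1
  have h6 : c / S ^ σ ≤ |ξ₁| / N := by
    rw [div_eq_mul_inv]; exact h1.trans h2
  rw [div_le_div_iff₀ hSp hN1] at h6
  rw [div_mul_eq_mul_div, div_le_iff₀ (by positivity)]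
  calc c * N ≤ |ξ₁| * S ^ σ := h6
    _ ≤ |ξ₁| * (B * (r.den : ℝ) ^ 2) := by gcongr; exact hS.trans hS2
    _ = _ := by ring


/-! ### Time spent near the zeros -/

/-- A nonnegative continuous function whose integral over each of `J` consecutive windows is at
least `m`. -/
lemma mul_le_integral_of_windows {Φ : ℝ → ℝ} (hΦ : Continuous Φ) {b q m : ℝ}
    (J : ℕ) (h : ∀ i : ℕ, m ≤ ∫ u in (b + i * q)..(b + (i + 1 : ℕ) * q), Φ u) :
    J * m ≤ ∫ u in b..(b + J * q), Φ u := by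
  have := intervalIntegral.sum_integral_adjacent_intervals (f := Φ) (μ := volume) (n := J)
    (a := fun i : ℕ => b + i * q) (fun k _ => hΦ.intervalIntegrable _ _)
  simp only [Nat.cast_zero, zero_mul, add_zero] at this
  rw [← this]
  calc (J : ℝ) * m = ∑ _i ∈ Finset.range J, m := by simp
    _ ≤ _ := Finset.sum_le_sum fun i _ => h i

/-- The occupation time lower bound: a line of Diophantine slope which visits the zeros of order
`γ` of `F` needs at least time `c Y ^ (γ / 2)` for a displacement `Y`. -/
lemma exists_rpow_le_integral_inv {ξ₁ ξ₂ σ : ℝ} (hξ : HasDiophantineIndex ξ₁ ξ₂ σ) (hσ : σ < 2)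
    {γ : ℝ} (hγ : 2 ≤ γ) {z K : ℝ} (hK : 0 ≤ K) {F : ℝ → ℝ} (hFc : Continuous F)
    (hF0 : ∀ u, 0 ≤ F u)
    (hF : ∀ (u : ℝ) (m n : ℤ),
      F u ≤ K * ((u - z - m) ^ 2 + (ξ₂ / ξ₁ * u - z - n) ^ 2) ^ (γ / 2)) :
    ∃ c : ℝ, 0 < c ∧ ∀ Y : ℝ, 4 ≤ Y → ∀ u₀ : ℝ, ∃ ε : ℝ, 0 < ε ∧
      c * Y ^ (γ / 2) ≤ ∫ u in u₀..(u₀ + Y), 1 / (F u + ε) := by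
  obtain ⟨c₀, hc₀, hq⟩ := hξ.exists_rat_den_sq_ge hσ
  set α := ξ₂ / ξ₁
  set B : ℝ := 1 + (2 + |α|) ^ 2
  have hB : 0 < B := by positivity
  set A : ℝ := K * B ^ (γ / 2) + 1
  have hA : 0 < A := by positivity
  refine ⟨c₀ ^ ((γ - 2) / 2) / (2 * A) * (1 / 2) ^ (γ / 2), by positivity, fun Y hY u₀ => ?_⟩
  -- The unit left between N and Y pays for moving the starting point up to z plus an integer.
  obtain ⟨N, hN1, hNY, hYN⟩ : ∃ N : ℕ, 0 < N ∧ (N : ℝ) + 1 ≤ Y ∧ Y / 2 ≤ N := by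
    have h1 : 4 ≤ ⌊Y⌋₊ := Nat.le_floor (by exact_mod_cast hY)
    have h2 : (⌊Y⌋₊ : ℝ) ≤ Y := Nat.floor_le (by linarith)
    have h3 : Y < ⌊Y⌋₊ + 1 := Nat.lt_floor_add_one Y
    refine ⟨⌊Y⌋₊ - 1, by omega, ?_, ?_⟩ <;> rw [Nat.cast_sub (by omega)] <;> push_cast <;> linarith
  obtain ⟨r, hr, hrN, hcr⟩ := hq N hN1
  set q : ℝ := (r.den : ℝ) with hqdef
  have hq1 : 1 ≤ q := by simp only [hqdef]; exact_mod_cast r.den_pos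
  have hq0 : 0 < q := by linarith
  have hNR : (0 : ℝ) < N := by exact_mod_cast hN1
  -- The regularization is of the size of F within 1/q of a zero, so it costs only a constant there
  -- while keeping the integrand continuous.
  refine ⟨q ^ (-γ), by positivity, ?_⟩
  set Φ : ℝ → ℝ := fun u => 1 / (F u + q ^ (-γ))
  have hpos : ∀ u, 0 < F u + q ^ (-γ) := fun u => by
    have := hF0 u
    positivity
  have hΦc : Continuous Φ := continuous_const.div (hFc.add continuous_const)
    fun u => (hpos u).ne'
  have hΦ0 : ∀ u, 0 ≤ Φ u := fun u => (one_div_pos.2 (hpos u)).le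
  have hΦi : ∀ a b, IntervalIntegrable Φ volume a b := fun a b => hΦc.intervalIntegrable a b
  have hwin : ∀ a : ℤ, q ^ (γ - 1) / A ≤ ∫ u in (z + a)..(z + a + q), Φ u := by
    intro a
    -- The shift αz − z turns closeness to an integer into closeness of the point over u = z + k to
    -- the zero (z + k, z + n).
    obtain ⟨k, n, hak, hka, hkn⟩ := exists_int_mem_window_near_int hr (α * z - z) a
    have hak' : (a : ℝ) ≤ k := by exact_mod_cast hak
    have hka' : (k : ℝ) + 1 ≤ a + q := by simp only [hqdef]; exact_mod_cast hka
    have hinv : 1 / q ≤ 1 := by rw [div_le_one hq0]; exact hq1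
    have hinv0 : 0 < 1 / q := by positivity
    have hsmall : ∀ u ∈ Set.Icc (z + k) (z + k + 1 / q), q ^ γ / A ≤ Φ u := by
      intro u hu
      have e1 : |u - z - k| ≤ 1 / q := by
        rw [abs_le]; constructor <;> linarith [hu.1, hu.2]
      have e2 : |α * u - z - n| ≤ (2 + |α|) / q := by
        have : α * u - z - n = (α * z - z + α * k - n) + α * (u - z - k) := by ring
        rw [this]
        calc _ ≤ _ := abs_add_le _ _
          _ ≤ 2 / q + |α| * (1 / q) := by
            rw [abs_mul]
            gcongr
          _ = _ := by ring
      have e3 : (u - z - k) ^ 2 + (α * u - z - n) ^ 2 ≤ B / q ^ 2 := by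
        have f1 := pow_le_pow_left₀ (abs_nonneg _) e1 2
        have f2 := pow_le_pow_left₀ (abs_nonneg _) e2 2
        rw [sq_abs] at f1 f2
        calc _ ≤ _ := add_le_add f1 f2
          _ = _ := by simp only [B]; ring
      have e4 : (B / q ^ 2) ^ (γ / 2) = B ^ (γ / 2) * q ^ (-γ) := by
        rw [Real.div_rpow hB.le (by positivity), ← Real.rpow_natCast, ← Real.rpow_mul hq0.le,
          Real.rpow_neg hq0.le, div_eq_mul_inv]
        congr 3
        push_cast; ring
      have e5 : F u + q ^ (-γ) ≤ A * q ^ (-γ) := by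
        have g := (hF u k n).trans
          (mul_le_mul_of_nonneg_left (Real.rpow_le_rpow (by positivity) e3 (by linarith)) hK)
        rw [e4] at g
        simp only [A]
        linarith
      calc q ^ γ / A = 1 / (A * q ^ (-γ)) := by
            rw [Real.rpow_neg hq0.le]; field_simp
        _ ≤ Φ u := one_div_le_one_div_of_le (hpos u) e5
    calc q ^ (γ - 1) / A = ∫ _u in (z + k)..(z + k + 1 / q), q ^ γ / A := by
          rw [intervalIntegral.integral_const, Real.rpow_sub hq0, Real.rpow_one, smul_eq_mul]
          ring
      _ ≤ ∫ u in (z + k)..(z + k + 1 / q), Φ u :=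
          intervalIntegral.integral_mono_on (by linarith) (by simp) (hΦi _ _) hsmall
      _ ≤ ∫ u in (z + a)..(z + a + q), Φ u :=
          intervalIntegral.integral_mono_interval (by linarith) (by linarith) (by linarith)
            (Eventually.of_forall hΦ0) (hΦi _ _)
  set J : ℕ := N / r.den
  have hJN : (J : ℝ) * q ≤ N := by
    simp only [hqdef]; exact_mod_cast Nat.div_mul_le_self N r.den
  -- Since q ≤ N there is at least one full window, so rounding down loses at most a factor 2.
  have hJ : (N : ℝ) / (2 * q) ≤ J := by
    have h1 : 1 ≤ J := Nat.div_pos hrN r.den_pos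
    have h2 : N < r.den * (J + 1) := Nat.lt_mul_div_succ N r.den_pos
    have h1' : (1 : ℝ) ≤ J := by exact_mod_cast h1
    have h2' : (N : ℝ) < q * (J + 1) := by simp only [hqdef]; exact_mod_cast h2
    rw [div_le_iff₀ (by positivity)]
    nlinarith
  set a : ℤ := ⌈u₀ - z⌉
  have ha1 : u₀ - z ≤ a := Int.le_ceil _
  have ha2 : (a : ℝ) < u₀ - z + 1 := Int.ceil_lt_add_one _
  have hsum : (J : ℝ) * (q ^ (γ - 1) / A) ≤ ∫ u in (z + a)..(z + a + J * q), Φ u := by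
    refine mul_le_integral_of_windows hΦc J fun i => ?_
    have := hwin (a + i * r.den)
    push_cast at this ⊢
    rw [show z + (a : ℝ) + i * q = z + (a + i * q) by ring,
      show z + (a : ℝ) + (i + 1) * q = z + (a + i * q) + q by ring]
    exact this
  have hJq : 0 ≤ (J : ℝ) * q := by positivity
  have hexp : c₀ ^ ((γ - 2) / 2) / (2 * A) * (N : ℝ) ^ (γ / 2) ≤ J * (q ^ (γ - 1) / A) := by
    have h1 : (c₀ * N) ^ ((γ - 2) / 2) ≤ q ^ (γ - 2) := by
      calc (c₀ * N) ^ ((γ - 2) / 2) ≤ (q ^ 2) ^ ((γ - 2) / 2) :=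
            Real.rpow_le_rpow (by positivity) hcr (by linarith)
        _ = q ^ (γ - 2) := by
          rw [← Real.rpow_natCast, ← Real.rpow_mul hq0.le]
          congr 1
          push_cast; ring
    rw [Real.mul_rpow hc₀.le hNR.le] at h1
    have h2 : (N : ℝ) ^ (γ / 2) = N * (N : ℝ) ^ ((γ - 2) / 2) := by
      rw [← Real.rpow_one_add' hNR.le (by linarith)]
      congr 1; ring
    have h3 : q ^ (γ - 1) = q * q ^ (γ - 2) := by
      rw [← Real.rpow_one_add' hq0.le (by linarith)]
      congr 1; ring
    calc c₀ ^ ((γ - 2) / 2) / (2 * A) * (N : ℝ) ^ (γ / 2)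
        = N / (2 * A) * (c₀ ^ ((γ - 2) / 2) * (N : ℝ) ^ ((γ - 2) / 2)) := by rw [h2]; ring
      _ ≤ N / (2 * A) * q ^ (γ - 2) := by gcongr
      _ = N / (2 * q) * (q ^ (γ - 1) / A) := by rw [h3]; field_simp
      _ ≤ J * (q ^ (γ - 1) / A) := by gcongr
  calc c₀ ^ ((γ - 2) / 2) / (2 * A) * (1 / 2) ^ (γ / 2) * Y ^ (γ / 2)
      = c₀ ^ ((γ - 2) / 2) / (2 * A) * (Y / 2) ^ (γ / 2) := by
        rw [mul_assoc, ← Real.mul_rpow (by norm_num) (by linarith)]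
        congr 2; ring
    _ ≤ c₀ ^ ((γ - 2) / 2) / (2 * A) * (N : ℝ) ^ (γ / 2) := by
        gcongr
    _ ≤ _ := hexp
    _ ≤ _ := hsum
    _ ≤ ∫ u in u₀..(u₀ + Y), Φ u :=
        intervalIntegral.integral_mono_interval (by linarith) (by linarith) (by linarith)
          (Eventually.of_forall hΦ0) (hΦi _ _)

end QPHomog

/-! ### Speed and travel time of calibrated curves -/

/-- Postcomposition with a Lipschitz map preserves absolute continuity. -/
lemma LipschitzWith.comp_absolutelyContinuousOnInterval {X Y : Type*} [PseudoMetricSpace X]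
    [PseudoMetricSpace Y] {G : X → Y} {κ : NNReal} (hG : LipschitzWith κ G) {η : ℝ → X} {a b : ℝ}
    (hη : AbsolutelyContinuousOnInterval η a b) :
    AbsolutelyContinuousOnInterval (G ∘ η) a b := by
  unfold AbsolutelyContinuousOnInterval at hη ⊢
  refine squeeze_zero (fun _ => Finset.sum_nonneg fun _ _ => dist_nonneg) (fun E => ?_)
    (by simpa using hη.const_mul (κ : ℝ))
  rw [Finset.mul_sum]
  exact Finset.sum_le_sum fun i _ => hG.dist_le_mul _ _

namespace QPHomog

/-- A curve of speed at most `f` spends at least the time `∫ 1 / (f + ε)` on its way. -/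
lemma abs_integral_inv_le_of_speed_le {f η : ℝ → ℝ} (hf : Continuous f) (hf0 : ∀ x, 0 ≤ f x)
    {ε t : ℝ} (hε : 0 < ε) (ht : 0 ≤ t) (hη : AbsolutelyContinuousOnInterval η 0 t)
    (hs : ∀ᵐ s, s ∈ Set.uIcc 0 t → DifferentiableAt ℝ η s ∧ |deriv η s| ≤ f (η s)) :
    |∫ x in (η 0)..(η t), 1 / (f x + ε)| ≤ t := by
  have hpos : ∀ x, 0 < f x + ε := fun x => by linarith [hf0 x]
  have hΦ : Continuous fun x => 1 / (f x + ε) :=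
    continuous_const.div (hf.add continuous_const) fun x => (hpos x).ne'
  set G : ℝ → ℝ := fun x => ∫ y in (0 : ℝ)..x, 1 / (f y + ε)
  have hGd : ∀ x, HasDerivAt G (1 / (f x + ε)) x := fun x => hΦ.integral_hasStrictDerivAt 0 x
    |>.hasDerivAt
  -- With ε > 0 the travel-time function G is globally Lipschitz, so G ∘ η is absolutely continuous
  -- and is recovered from its derivative, which is at most 1 in absolute value.
  have hGL : LipschitzWith (Real.toNNReal (1 / ε)) G := by
    refine lipschitzWith_of_nnnorm_deriv_le (fun x => (hGd x).differentiableAt) fun x => ?_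
    rw [(hGd x).deriv, ← NNReal.coe_le_coe, coe_nnnorm, Real.coe_toNNReal _ (by positivity),
      Real.norm_of_nonneg (one_div_pos.2 (hpos x)).le]
    exact one_div_le_one_div_of_le hε (by linarith [hf0 x])
  have hAC := hGL.comp_absolutelyContinuousOnInterval hη
  have h1 : ∫ x in (η 0)..(η t), 1 / (f x + ε) = G (η t) - G (η 0) :=
    (intervalIntegral.integral_interval_sub_left (hΦ.intervalIntegrable _ _)
      (hΦ.intervalIntegrable _ _)).symm
  have h2 : G (η t) - G (η 0) = ∫ s in (0 : ℝ)..t, deriv (G ∘ η) s :=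
    hAC.integral_deriv_eq_sub.symm
  rw [h1, h2]
  have h3 : ‖∫ s in (0 : ℝ)..t, deriv (G ∘ η) s‖ ≤ 1 * |t - 0| := by
    refine intervalIntegral.norm_integral_le_of_norm_le_const_ae ?_
    filter_upwards [hs] with s hs hst
    obtain ⟨hd, hle⟩ := hs (Set.uIoc_subset_uIcc hst)
    rw [((hGd (η s)).comp s hd.hasDerivAt).deriv, norm_mul,
      Real.norm_of_nonneg (one_div_pos.2 (hpos _)).le, Real.norm_eq_abs, div_mul_eq_mul_div, one_mul,
      div_le_one (hpos _)]
    linarith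
  rwa [one_mul, sub_zero, abs_of_nonneg ht] at h3

lemma lagrangian_mechHamiltonian (U : ℝ → ℝ → ℝ) (ξ₁ ξ₂ x w : ℝ) :
    lagrangian (mechHamiltonian U ξ₁ ξ₂) x w = w ^ 2 / 2 + U (ξ₁ * x) (ξ₂ * x) := by
  have hle : ∀ p, p * w - mechHamiltonian U ξ₁ ξ₂ x p ≤ w ^ 2 / 2 + U (ξ₁ * x) (ξ₂ * x) := by
    intro p
    simp only [mechHamiltonian, sq_abs]
    nlinarith [sq_nonneg (p - w)]
  refine le_antisymm (ciSup_le hle) ?_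
  refine le_ciSup_of_le ⟨_, Set.forall_mem_range.2 hle⟩ w ?_
  simp only [mechHamiltonian, sq_abs]
  linarith

/-- When the effective Hamiltonian is nonpositive, a characteristic has speed at most `√(2U)`. -/
lemma IsCharacteristic.ae_abs_deriv_le {U : ℝ → ℝ → ℝ} {ξ₁ ξ₂ p : ℝ}
    (hE : effHamiltonian (mechHamiltonian U ξ₁ ξ₂) p ≤ 0)
    {η : ℝ → ℝ} (h : IsCharacteristic (mechHamiltonian U ξ₁ ξ₂) p η) {t : ℝ} (ht : 0 ≤ t) :
    ∀ᵐ s, s ∈ Set.uIcc 0 t → DifferentiableAt ℝ η s ∧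
      |deriv η s| ≤ Real.sqrt (2 * U (ξ₁ * η s) (ξ₂ * η s)) := by
  obtain ⟨v, ⟨hv, hvH, -⟩, hcal⟩ := h
  obtain ⟨hAC, hint, -⟩ := hcal 0 t le_rfl ht
  -- Differentiating the calibration identity needs a two-sided neighbourhood, and the identity is
  -- known only on [0, ∞).
  have hne : ∀ᵐ s : ℝ, s ≠ 0 := by simp [ae_iff, measure_singleton]
  filter_upwards [hAC.ae_differentiableAt, hint.ae_hasDerivAt_integral, hne] with s hs1 hs2 hs0 hs
  have hd := hs1 hs
  have hI := hs2 hs 0 Set.left_mem_uIcc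
  rw [Set.uIcc_of_le ht] at hs
  have hspos : 0 < s := lt_of_le_of_ne hs.1 (Ne.symm hs0)
  refine ⟨hd, Real.abs_le_sqrt ?_⟩
  have hvd : HasDerivAt v (deriv v (η s)) (η s) :=
    ((hv.differentiable one_ne_zero) (η s)).hasDerivAt
  have hR : HasDerivAt (fun x => p * η x - p * η 0 + v (η x) - v (η 0))
      (p * deriv η s + deriv v (η s) * deriv η s) s :=
    (((hd.hasDerivAt.const_mul p).sub_const _).add (hvd.comp s hd.hasDerivAt)).sub_const _
  have heq : (fun x => ∫ r in (0 : ℝ)..x, (lagrangian (mechHamiltonian U ξ₁ ξ₂) (η r) (deriv η r) +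
      effHamiltonian (mechHamiltonian U ξ₁ ξ₂) p)) =ᶠ[𝓝 s]
      fun x => p * η x - p * η 0 + v (η x) - v (η 0) := by
    filter_upwards [lt_mem_nhds hspos] with x hx
    exact (hcal 0 x le_rfl hx.le).2.2
  have hkey := hI.unique (hR.congr_of_eventuallyEq heq)
  have hH := hvH (η s)
  rw [lagrangian_mechHamiltonian] at hkey
  simp only [mechHamiltonian, sq_abs] at hH
  -- The differentiated calibration identity and the corrector equation give equality in Young's
  -- inequality, whose defect is half this square.
  have hsq : (deriv η s - (p + deriv v (η s))) ^ 2 = 0 := by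
    nlinarith
  have : deriv η s = p + deriv v (η s) := by
    have := pow_eq_zero_iff (two_ne_zero) |>.1 hsq
    linarith
  rw [this]
  change _ / 2 + -_ = effHamiltonian (mechHamiltonian U ξ₁ ξ₂) p at hH
  linarith


/-! ### Sign of the effective Hamiltonian -/

lemma isApproxCorrector_of_hasDerivAt {H : ℝ → ℝ → ℝ} {p δ : ℝ} {w g : ℝ → ℝ}
    (hb : ∃ M, ∀ x, |w x| ≤ M) (hL : ∃ K : NNReal, LipschitzWith K w)
    (hw : ∀ x, HasDerivAt w (g x) x) (h : ∀ x, |H x (p + g x)| ≤ δ) :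
    IsApproxCorrector H p 0 δ w := by
  have key : ∀ φ : ℝ → ℝ, ContDiff ℝ 1 φ → ∀ x : ℝ, IsLocalExtr (fun y => w y - φ y) x →
      |H x (p + deriv φ x)| ≤ δ := by
    intro φ hφ x hx
    have hd := (hw x).sub ((hφ.differentiable one_ne_zero) x).hasDerivAt
    have h0 := hx.hasDerivAt_eq_zero hd
    rw [← sub_eq_zero.1 h0]
    exact h x
  refine ⟨hb, hL, fun φ hφ x hx => ?_, fun φ hφ x hx => ?_⟩
  · have := (abs_le.1 (key φ hφ x (Or.inl hx))).1
    linarith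
  · have := (abs_le.1 (key φ hφ x (Or.inr hx))).2
    linarith

lemma hasDerivAt_sqrt_one_add_sq (x : ℝ) :
    HasDerivAt (fun y : ℝ => Real.sqrt (1 + y ^ 2)) (x / Real.sqrt (1 + x ^ 2)) x := by
  have h := ((hasDerivAt_pow 2 x).const_add 1).sqrt (by positivity)
  convert h using 1
  simp
  field_simp

lemma abs_div_sqrt_one_add_sq_le (x : ℝ) : |x / Real.sqrt (1 + x ^ 2)| ≤ 1 := by
  have h : |x| ≤ Real.sqrt (1 + x ^ 2) := Real.abs_le_sqrt (by linarith)
  rw [abs_div, abs_of_nonneg (Real.sqrt_nonneg _)]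
  exact div_le_one_of_le₀ h (Real.sqrt_nonneg _)

/-- Penalized comparison of a bounded viscosity supersolution with a bounded `C¹` function. -/
lemma IsViscositySuper.exists_le_of_contDiff {H : ℝ → ℝ → ℝ} {p c μ : ℝ} (hμ : 0 < μ)
    {w w₀ : ℝ → ℝ} (hw : IsViscositySuper H p c w) (hwc : Continuous w)
    (hwb : ∃ M, ∀ x, |w x| ≤ M) (hw₀ : ContDiff ℝ 1 w₀) (hw₀b : ∃ M, ∀ x, |w₀ x| ≤ M) :
    ∃ x s : ℝ, |s| ≤ μ ∧ c ≤ H x (p + (deriv w₀ x + s)) := by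
  obtain ⟨M, hM⟩ := hwb
  obtain ⟨M₀, hM₀⟩ := hw₀b
  have hsq : ∀ y : ℝ, 1 + y ^ 2 ≠ 0 := fun y => by positivity
  have hpen : Tendsto (fun y : ℝ => w y - (w₀ y - μ * Real.sqrt (1 + y ^ 2))) (cocompact ℝ)
      atTop := by
    have h1 : Tendsto (fun y : ℝ => -(M + M₀) + μ * ‖y‖) (cocompact ℝ) atTop :=
      tendsto_atTop_add_const_left _ _
        (Tendsto.const_mul_atTop hμ (tendsto_norm_cocompact_atTop (E := ℝ)))
    refine tendsto_atTop_mono (fun y => ?_) h1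
    have h2 : |y| ≤ Real.sqrt (1 + y ^ 2) := Real.abs_le_sqrt (by linarith)
    have h3 := mul_le_mul_of_nonneg_left h2 hμ.le
    have h4 := (abs_le.1 (hM y)).1
    have h5 := (abs_le.1 (hM₀ y)).2
    rw [Real.norm_eq_abs]
    linarith
  have hφ : ContDiff ℝ 1 fun y : ℝ => w₀ y - μ * Real.sqrt (1 + y ^ 2) :=
    hw₀.sub (contDiff_const.mul ((contDiff_const.add (contDiff_id.pow 2)).sqrt hsq))
  -- The penalty forces a minimum to exist on the noncompact line, while its slope stays below μ.
  obtain ⟨x, hx⟩ := (hwc.sub hφ.continuous).exists_forall_le hpen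
  refine ⟨x, -(μ * (x / Real.sqrt (1 + x ^ 2))), ?_, ?_⟩
  · rw [abs_neg, abs_mul, abs_of_pos hμ]
    exact mul_le_of_le_one_right hμ.le (abs_div_sqrt_one_add_sq_le x)
  · have h := hw _ hφ x (Eventually.of_forall hx)
    have hd := (((hw₀.differentiable one_ne_zero) x).hasDerivAt.sub
      ((hasDerivAt_sqrt_one_add_sq x).const_mul μ)).deriv
    have e : deriv (fun y : ℝ => w₀ y - μ * Real.sqrt (1 + y ^ 2)) x =
      deriv w₀ x + -(μ * (x / Real.sqrt (1 + x ^ 2))) := by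
      rw [← sub_eq_add_neg]; exact hd
    rwa [e] at h

/-- If `√(2U) - p` along the line is a uniform limit of continuous functions with bounded
primitives, then the effective Hamiltonian at `p` is nonpositive. -/
lemma effHamiltonian_nonpos {U : ℝ → ℝ → ℝ} (hU : ∀ x y, 0 ≤ U x y) {ξ₁ ξ₂ p B : ℝ}
    (hB : ∀ x y, Real.sqrt (2 * U x y) ≤ B)
    (happ : ∀ ε : ℝ, 0 < ε → ∃ g : ℝ → ℝ, Continuous g ∧
      (∀ x, |p + g x - Real.sqrt (2 * U (ξ₁ * x) (ξ₂ * x))| ≤ ε) ∧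
      ∃ M, ∀ x, |∫ s in (0 : ℝ)..x, g s| ≤ M) :
    effHamiltonian (mechHamiltonian U ξ₁ ξ₂) p ≤ 0 := by
  set H := mechHamiltonian U ξ₁ ξ₂
  have hB0 : 0 ≤ B := (Real.sqrt_nonneg _).trans (hB 0 0)
  have hHsq : ∀ x q, H x q = (q ^ 2 - Real.sqrt (2 * U (ξ₁ * x) (ξ₂ * x)) ^ 2) / 2 := by
    intro x q
    rw [Real.sq_sqrt (by linarith [hU (ξ₁ * x) (ξ₂ * x)])]
    simp only [H, mechHamiltonian, sq_abs]
    ring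
  have hHest : ∀ (x q ε : ℝ), ε ≤ 1 →
      |q - Real.sqrt (2 * U (ξ₁ * x) (ξ₂ * x))| ≤ ε → |H x q| ≤ ε * (B + 1) := by
    intro x q ε hε1 hq
    set f := Real.sqrt (2 * U (ξ₁ * x) (ξ₂ * x))
    have hfB : f ≤ B := hB _ _
    have hf0 : 0 ≤ f := Real.sqrt_nonneg _
    have hε0 : 0 ≤ ε := (abs_nonneg _).trans hq
    rw [hHsq, show (q ^ 2 - f ^ 2) / 2 = (q - f) * ((q + f) / 2) by ring, abs_mul]
    have hq2 := abs_le.1 hq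
    gcongr
    rw [abs_le]; constructor <;> linarith
  have hw : ∀ ε : ℝ, 0 < ε → ε ≤ 1 → ∃ w : ℝ → ℝ, ContDiff ℝ 1 w ∧
      (∀ x, |p + deriv w x - Real.sqrt (2 * U (ξ₁ * x) (ξ₂ * x))| ≤ ε) ∧
      (∃ M, ∀ x, |w x| ≤ M) ∧ ∃ K : NNReal, LipschitzWith K w := by
    intro ε hε hε1
    obtain ⟨g, hgc, hg, hM⟩ := happ ε hε
    have hd : ∀ x, HasDerivAt (fun x => ∫ s in (0 : ℝ)..x, g s) (g x) x := fun x =>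
      (hgc.integral_hasStrictDerivAt 0 x).hasDerivAt
    have hdg : deriv (fun x => ∫ s in (0 : ℝ)..x, g s) = g := funext fun x => (hd x).deriv
    refine ⟨fun x => ∫ s in (0 : ℝ)..x, g s, ?_, ?_, hM, Real.toNNReal (B + |p| + 1), ?_⟩
    · rw [contDiff_one_iff_deriv, hdg]
      exact ⟨fun x => (hd x).differentiableAt, hgc⟩
    · rw [hdg]; exact hg
    · refine lipschitzWith_of_nnnorm_deriv_le (fun x => (hd x).differentiableAt) fun x => ?_
      rw [hdg, ← NNReal.coe_le_coe, coe_nnnorm, Real.coe_toNNReal _ (by positivity),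
        Real.norm_eq_abs]
      have h1 := abs_le.1 (hg x)
      have h2 := hB (ξ₁ * x) (ξ₂ * x)
      have h3 := Real.sqrt_nonneg (2 * U (ξ₁ * x) (ξ₂ * x))
      have h4 := neg_abs_le p
      have h5 := le_abs_self p
      rw [abs_le]; constructor <;> linarith
  -- The effective Hamiltonian is a choice, so some admissible value must be exhibited before
  -- anything is known about it; 0 is one.
  have hex : ∃ c : ℝ, ∀ δ : ℝ, 0 < δ → ∃ w : ℝ → ℝ, IsApproxCorrector H p c δ w := by
    refine ⟨0, fun δ hδ => ?_⟩
    have hε : 0 < min 1 (δ / (B + 1)) := by positivity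
    obtain ⟨w, hwc, hwd, hwb, hwL⟩ := hw _ hε (min_le_left _ _)
    refine ⟨w, isApproxCorrector_of_hasDerivAt hwb hwL
      (fun x => ((hwc.differentiable one_ne_zero) x).hasDerivAt) fun x => ?_⟩
    refine (hHest x _ _ (min_le_left _ _) (hwd x)).trans ?_
    rw [← le_div_iff₀ (by positivity)]
    exact min_le_right _ _
  have hspec : ∀ δ : ℝ, 0 < δ → ∃ w : ℝ → ℝ, IsApproxCorrector H p (effHamiltonian H p) δ w :=
    Classical.epsilon_spec hex
  set c := effHamiltonian H p
  by_contra! hc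
  -- Comparison with error c/2 will give c/2 ≤ 2ε(B + 1) ≤ c/4, a contradiction.
  set ε := min (1 / 2) (c / (8 * (B + 1)))
  have hε : 0 < ε := by positivity
  have hε1 : ε ≤ 1 / 2 := min_le_left _ _
  have hεc : ε * (8 * (B + 1)) ≤ c := by
    rw [← le_div_iff₀ (by positivity)]; exact min_le_right _ _
  obtain ⟨w, hwb, ⟨K, hwK⟩, hsup, -⟩ := hspec (c / 2) (by linarith)
  obtain ⟨w₀, hw₀c, hw₀d, hw₀b, -⟩ := hw ε hε (by linarith)
  obtain ⟨x, s, hs, hle⟩ := hsup.exists_le_of_contDiff hε hwK.continuous hwb hw₀c hw₀b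
  have h1 : |H x (p + (deriv w₀ x + s))| ≤ (2 * ε) * (B + 1) := by
    refine hHest x _ _ (by linarith) ?_
    rw [show p + (deriv w₀ x + s) - Real.sqrt (2 * U (ξ₁ * x) (ξ₂ * x)) =
      (p + deriv w₀ x - Real.sqrt (2 * U (ξ₁ * x) (ξ₂ * x))) + s by ring]
    exact (abs_add_le _ _).trans (by linarith [hw₀d x])
  have h2 := (abs_le.1 h1).2
  linarith


/-! ### Bounded primitives along nonresonant lines -/

/-- The point of the two-dimensional torus with given coordinates. -/
def torusPoint (x y : ℝ) : UnitAddTorus (Fin 2) :=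
  ![(x : UnitAddCircle), (y : UnitAddCircle)]

@[fun_prop]
lemma Continuous.torusPoint {X : Type*} [TopologicalSpace X] {a b : X → ℝ} (ha : Continuous a)
    (hb : Continuous b) : Continuous fun t => torusPoint (a t) (b t) := by
  refine continuous_pi fun i => ?_
  fin_cases i
  · exact (AddCircle.continuous_mk' 1).comp ha
  · exact (AddCircle.continuous_mk' 1).comp hb

/-- The mean of a continuous function on the torus, as an iterated integral. -/
noncomputable def torusMean (g : C(UnitAddTorus (Fin 2), ℂ)) : ℂ :=
  ∫ x in (0 : ℝ)..1, ∫ y in (0 : ℝ)..1, g (torusPoint x y)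

lemma continuous_inner_torusMean (g : C(UnitAddTorus (Fin 2), ℂ)) :
    Continuous fun x : ℝ => ∫ y in (0 : ℝ)..1, g (torusPoint x y) := by
  refine intervalIntegral.continuous_parametric_intervalIntegral_of_continuous'
    (f := fun x y => g (torusPoint x y)) ?_ 0 1
  simp only [Function.uncurry_def]
  fun_prop

lemma intervalIntegrable_torus (g : C(UnitAddTorus (Fin 2), ℂ)) (x a b : ℝ) :
    IntervalIntegrable (fun y => g (torusPoint x y)) volume a b :=
  Continuous.intervalIntegrable (by fun_prop) _ _

lemma torusMean_add (g h : C(UnitAddTorus (Fin 2), ℂ)) :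
    torusMean (g + h) = torusMean g + torusMean h := by
  simp only [torusMean, ContinuousMap.add_apply]
  rw [← intervalIntegral.integral_add ((continuous_inner_torusMean g).intervalIntegrable _ _)
    ((continuous_inner_torusMean h).intervalIntegrable _ _)]
  congr 1 with x
  exact intervalIntegral.integral_add (intervalIntegrable_torus g x _ _)
    (intervalIntegrable_torus h x _ _)

lemma torusMean_smul (c : ℂ) (g : C(UnitAddTorus (Fin 2), ℂ)) :
    torusMean (c • g) = c * torusMean g := by
  simp only [torusMean, ContinuousMap.smul_apply, smul_eq_mul,
    intervalIntegral.integral_const_mul]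

lemma torusMean_zero : torusMean 0 = 0 := by simp [torusMean]

lemma norm_torusMean_sub_le (g h : C(UnitAddTorus (Fin 2), ℂ)) :
    ‖torusMean g - torusMean h‖ ≤ ‖g - h‖ := by
  have e : torusMean g - torusMean h = torusMean (g - h) := by
    have := torusMean_add (g - h) h
    rw [sub_add_cancel] at this
    rw [this, add_sub_cancel_right]
  rw [e]
  have h1 : ∀ x, ‖∫ y in (0 : ℝ)..1, (g - h) (torusPoint x y)‖ ≤ ‖g - h‖ := fun x => by
    simpa using intervalIntegral.norm_integral_le_of_norm_le_const (a := (0 : ℝ)) (b := 1)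
      (f := fun y => (g - h) (torusPoint x y)) fun y _ => (g - h).norm_coe_le_norm _
  simpa [torusMean] using intervalIntegral.norm_integral_le_of_norm_le_const (a := (0 : ℝ)) (b := 1)
    (f := fun x => ∫ y in (0 : ℝ)..1, (g - h) (torusPoint x y)) fun x _ => h1 x

/-- The primitive of `g - mean g` along the line of direction `(ξ₁, ξ₂)` is bounded. -/
def HasBoundedPrimitive (ξ₁ ξ₂ : ℝ) (g : C(UnitAddTorus (Fin 2), ℂ)) : Prop :=
  ∃ M : ℝ, ∀ x : ℝ, ‖∫ s in (0 : ℝ)..x, (g (torusPoint (ξ₁ * s) (ξ₂ * s)) - torusMean g)‖ ≤ M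

lemma mFourier_torusPoint (n : Fin 2 → ℤ) (x y : ℝ) :
    UnitAddTorus.mFourier n (torusPoint x y) =
      Complex.exp (2 * Real.pi * Complex.I * (n 0 * x + n 1 * y : ℝ)) := by
  simp only [UnitAddTorus.mFourier, torusPoint, ContinuousMap.coe_mk, Fin.prod_univ_two,
    Matrix.cons_val_zero, Matrix.cons_val_one, fourier_coe_apply]
  rw [← Complex.exp_add]
  congr 1
  push_cast
  ring

lemma integral_exp_two_pi_int {k : ℤ} (hk : k ≠ 0) (c : ℂ) :
    ∫ y in (0 : ℝ)..1, Complex.exp (2 * Real.pi * Complex.I * k * y + c) = 0 := by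
  have hk' : (2 * Real.pi * Complex.I * k : ℂ) ≠ 0 := by
    simp [Real.pi_ne_zero, hk]
  simp_rw [Complex.exp_add, intervalIntegral.integral_mul_const]
  rw [integral_exp_mul_complex hk']
  have : Complex.exp (2 * Real.pi * Complex.I * k * (1 : ℝ)) = 1 := by
    rw [Complex.exp_eq_one_iff]
    exact ⟨k, by push_cast; ring⟩
  rw [this]
  simp

lemma torusMean_mFourier {n : Fin 2 → ℤ} (hn : n ≠ 0) :
    torusMean (UnitAddTorus.mFourier n) = 0 := by
  simp only [torusMean, mFourier_torusPoint]
  by_cases h1 : n 1 = 0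
  · have h0 : n 0 ≠ 0 := fun h0 => hn (by ext i; fin_cases i <;> simp [h0, h1])
    simp only [h1, Int.cast_zero, zero_mul, add_zero, intervalIntegral.integral_const, sub_zero,
      one_smul]
    refine Eq.trans (intervalIntegral.integral_congr fun x _ => ?_) (integral_exp_two_pi_int h0 0)
    congr 1
    push_cast; ring
  · refine Eq.trans (intervalIntegral.integral_congr (g := fun _ => 0) fun x _ => ?_) (by simp)
    refine Eq.trans (intervalIntegral.integral_congr fun y _ => ?_)
      (integral_exp_two_pi_int h1 (2 * Real.pi * Complex.I * (n 0 * x)))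
    congr 1
    push_cast; ring

/-- Along the line a nonconstant mode is exp(2πiωs) with ω ≠ 0 by nonresonance, so its primitive is
bounded by 2/|2πω|; no uniformity in the mode is needed. -/
lemma hasBoundedPrimitive_mFourier {ξ₁ ξ₂ : ℝ}
    (hres : ∀ k l : ℤ, ξ₁ * k + ξ₂ * l = 0 → k = 0 ∧ l = 0) (n : Fin 2 → ℤ) :
    HasBoundedPrimitive ξ₁ ξ₂ (UnitAddTorus.mFourier n) := by
  by_cases hn : n = 0
  · subst hn
    refine ⟨0, fun x => ?_⟩
    simp [UnitAddTorus.mFourier_zero, torusMean]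
  · have hω : n 0 * ξ₁ + n 1 * ξ₂ ≠ 0 := fun h => by
      obtain ⟨h0, h1⟩ := hres (n 0) (n 1) (by linarith)
      exact hn (by ext i; fin_cases i <;> simp [h0, h1])
    set ω : ℝ := n 0 * ξ₁ + n 1 * ξ₂
    set a : ℂ := 2 * Real.pi * Complex.I * ω
    have ha : a ≠ 0 := by
      simp [a, Real.pi_ne_zero, hω]
    refine ⟨2 / ‖a‖, fun x => ?_⟩
    have e : ∀ s : ℝ, UnitAddTorus.mFourier n (torusPoint (ξ₁ * s) (ξ₂ * s)) -
        torusMean (UnitAddTorus.mFourier n) = Complex.exp (a * s) := by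
      intro s
      rw [torusMean_mFourier hn, sub_zero, mFourier_torusPoint]
      congr 1
      simp only [a, ω]
      push_cast; ring
    simp_rw [e]
    rw [integral_exp_mul_complex ha, norm_div]
    gcongr
    have : ‖Complex.exp (a * x)‖ = 1 := by
      rw [Complex.norm_exp]
      simp [a]
    calc _ ≤ _ := norm_sub_le _ _
      _ = 2 := by rw [this]; norm_num

lemma intervalIntegrable_line (ξ₁ ξ₂ : ℝ) (g : C(UnitAddTorus (Fin 2), ℂ)) (a b : ℝ) :
    IntervalIntegrable (fun s => g (torusPoint (ξ₁ * s) (ξ₂ * s)) - torusMean g) volume a b :=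
  Continuous.intervalIntegrable (by fun_prop) _ _

lemma hasBoundedPrimitive_of_mem_span {ξ₁ ξ₂ : ℝ}
    (hres : ∀ k l : ℤ, ξ₁ * k + ξ₂ * l = 0 → k = 0 ∧ l = 0) {g : C(UnitAddTorus (Fin 2), ℂ)}
    (hg : g ∈ Submodule.span ℂ (Set.range (UnitAddTorus.mFourier (d := Fin 2)))) :
    HasBoundedPrimitive ξ₁ ξ₂ g := by
  induction hg using Submodule.span_induction with
  | mem g hg =>
    obtain ⟨n, rfl⟩ := hg
    exact hasBoundedPrimitive_mFourier hres n
  | zero => exact ⟨0, fun x => by simp [torusMean_zero]⟩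
  | add g h _ _ hg hh =>
    obtain ⟨M, hM⟩ := hg
    obtain ⟨M', hM'⟩ := hh
    refine ⟨M + M', fun x => ?_⟩
    have := intervalIntegral.integral_add (intervalIntegrable_line ξ₁ ξ₂ g 0 x)
      (intervalIntegrable_line ξ₁ ξ₂ h 0 x)
    simp only [torusMean_add, ContinuousMap.add_apply, add_sub_add_comm]
    rw [this]
    exact (norm_add_le _ _).trans (add_le_add (hM x) (hM' x))
  | smul c g _ hg =>
    obtain ⟨M, hM⟩ := hg
    refine ⟨‖c‖ * M, fun x => ?_⟩
    simp only [torusMean_smul, ContinuousMap.smul_apply, smul_eq_mul, ← mul_sub,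
      intervalIntegral.integral_const_mul, norm_mul]
    gcongr
    exact hM x

/-- A real continuous function on the torus, minus its mean, is along a nonresonant line a uniform
limit of continuous functions with bounded primitives. -/
lemma exists_approx_boundedPrimitive {ξ₁ ξ₂ : ℝ}
    (hres : ∀ k l : ℤ, ξ₁ * k + ξ₂ * l = 0 → k = 0 ∧ l = 0) {f : ℝ → ℝ → ℝ}
    {F : C(UnitAddTorus (Fin 2), ℂ)} (hF : ∀ x y, F (torusPoint x y) = f x y) {ε : ℝ}
    (hε : 0 < ε) :
    ∃ g : ℝ → ℝ, Continuous g ∧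
      (∀ x, |(∫ x in (0 : ℝ)..1, ∫ y in (0 : ℝ)..1, f x y) + g x - f (ξ₁ * x) (ξ₂ * x)| ≤ ε) ∧
      ∃ M, ∀ x, |∫ s in (0 : ℝ)..x, g s| ≤ M := by
  have hmem : F ∈ (Submodule.span ℂ
      (Set.range (UnitAddTorus.mFourier (d := Fin 2)))).topologicalClosure := by
    rw [UnitAddTorus.span_mFourier_closure_eq_top]
    trivial
  -- Half of ε is for the values and half for the means.
  obtain ⟨P, hP, hPF⟩ := Metric.mem_closure_iff.1 hmem (ε / 2) (by positivity)
  rw [dist_comm, dist_eq_norm] at hPF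
  obtain ⟨M, hM⟩ := hasBoundedPrimitive_of_mem_span hres hP
  refine ⟨fun s => (P (torusPoint (ξ₁ * s) (ξ₂ * s)) - torusMean P).re, ?_, fun x => ?_, M,
    fun x => ?_⟩
  · exact Complex.continuous_re.comp (by fun_prop)
  · have hmean : torusMean F = ((∫ x in (0 : ℝ)..1, ∫ y in (0 : ℝ)..1, f x y : ℝ) : ℂ) := by
      simp only [torusMean, hF, intervalIntegral.integral_ofReal]
    set p : ℝ := ∫ x in (0 : ℝ)..1, ∫ y in (0 : ℝ)..1, f x y
    have e : p + (P (torusPoint (ξ₁ * x) (ξ₂ * x)) - torusMean P).re - f (ξ₁ * x) (ξ₂ * x) =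
        ((P - F) (torusPoint (ξ₁ * x) (ξ₂ * x)) - (torusMean P - torusMean F)).re := by
      rw [ContinuousMap.sub_apply, hF, hmean]
      simp
      ring
    rw [e]
    refine (Complex.abs_re_le_norm _).trans ((norm_sub_le _ _).trans ?_)
    have h1 := (P - F).norm_coe_le_norm (torusPoint (ξ₁ * x) (ξ₂ * x))
    have h2 := norm_torusMean_sub_le P F
    linarith
  · have e : ∫ s in (0 : ℝ)..x, (P (torusPoint (ξ₁ * s) (ξ₂ * s)) - torusMean P).re =
        (∫ s in (0 : ℝ)..x, (P (torusPoint (ξ₁ * s) (ξ₂ * s)) - torusMean P)).re :=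
      (Complex.reCLM.intervalIntegral_comp_comm (intervalIntegrable_line ξ₁ ξ₂ P 0 x))
    rw [e]
    exact (Complex.abs_re_le_norm _).trans (hM x)


/-! ### Comparison of exponents -/

lemma lt_improvedRate {γ : ℝ} (hγ : 2 < γ) : (γ - 2) / (3 * γ - 2) < improvedRate γ := by
  have h1 : 0 < γ - 2 := by linarith
  have h2 : 0 < 3 * γ - 2 := by linarith
  rw [improvedRate, div_lt_div_iff₀ h2 (by positivity)]
  have : 0 < (γ - 2) * (2 * γ * (γ - 2)) := by positivity
  nlinarith

lemma improvedRate_pos {γ : ℝ} (hγ : 2 < γ) : 0 < improvedRate γ :=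
  (div_pos (by linarith) (by linarith)).trans (lt_improvedRate hγ)

/-- After clearing denominators the difference is 2(γ − 2)(2γ² − 3γ + 2). The occupation-time
exponent 2/γ is thus at least as good as the one required. -/
lemma two_div_le_one_sub_improvedRate {γ : ℝ} (hγ : 2 < γ) : 2 / γ ≤ 1 - improvedRate γ := by
  have h1 : 0 < γ - 2 := by linarith
  have h2 : 0 < 3 * γ - 2 := by linarith
  have hD : 0 < (γ - 2) * (3 * γ - 2) + 4 * γ ^ 2 := by positivity
  have e : 1 - improvedRate γ = 4 * γ ^ 2 / ((γ - 2) * (3 * γ - 2) + 4 * γ ^ 2) := by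
    rw [improvedRate, eq_div_iff hD.ne', sub_mul, div_mul_cancel₀ _ hD.ne']; ring
  rw [e, div_le_div_iff₀ (by linarith) hD]
  have : 0 ≤ (γ - 2) * (2 * γ * (2 * γ - 3) + 4) := by
    have : 0 < 2 * γ - 3 := by linarith
    positivity
  nlinarith

/-! ### The two prototypes -/

/-- A translate of the second prototype along the diagonal. -/
noncomputable def shiftedPotential (γ z x y : ℝ) : ℝ :=
  (2 - Real.cos (2 * Real.pi * (x - z)) - Real.cos (2 * Real.pi * (y - z))) ^ γ

lemma sinPotential_eq (γ : ℝ) : sinPotential γ = shiftedPotential γ (1 / 4) := by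
  have h : ∀ x, Real.cos (2 * Real.pi * (x - 1 / 4)) = Real.sin (2 * Real.pi * x) := fun x => by
    rw [← Real.cos_sub_pi_div_two]; congr 1; ring
  ext x y
  simp only [sinPotential, shiftedPotential, h]

lemma cosPotential_eq (γ : ℝ) : cosPotential γ = shiftedPotential γ 0 := by
  ext x y
  simp only [cosPotential, shiftedPotential, sub_zero]

lemma two_sub_cos_nonneg (a b : ℝ) : 0 ≤ 2 - Real.cos a - Real.cos b := by
  linarith [Real.cos_le_one a, Real.cos_le_one b]

lemma shiftedPotential_nonneg (γ z x y : ℝ) : 0 ≤ shiftedPotential γ z x y :=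
  Real.rpow_nonneg (two_sub_cos_nonneg _ _) _

lemma continuous_shiftedPotential {γ : ℝ} (hγ : 0 ≤ γ) (z : ℝ) {a b : ℝ → ℝ} (ha : Continuous a)
    (hb : Continuous b) : Continuous fun x => shiftedPotential γ z (a x) (b x) := by
  unfold shiftedPotential
  exact Continuous.rpow_const (by fun_prop) fun _ => Or.inr hγ

lemma sqrt_shiftedPotential_le {γ : ℝ} (hγ : 0 ≤ γ) (z x y : ℝ) :
    Real.sqrt (2 * shiftedPotential γ z x y) ≤ Real.sqrt (2 * 4 ^ γ) := by
  apply Real.sqrt_le_sqrt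
  unfold shiftedPotential
  have := Real.rpow_le_rpow (two_sub_cos_nonneg (2 * Real.pi * (x - z)) (2 * Real.pi * (y - z)))
    (show _ ≤ (4 : ℝ) by linarith [Real.neg_one_le_cos (2 * Real.pi * (x - z)),
      Real.neg_one_le_cos (2 * Real.pi * (y - z))]) hγ
  linarith

lemma one_sub_cos_le (x : ℝ) (m : ℤ) :
    1 - Real.cos (2 * Real.pi * x) ≤ 2 * Real.pi ^ 2 * (x - m) ^ 2 := by
  have h := Real.one_sub_sq_div_two_le_cos (x := 2 * Real.pi * (x - m))
  have e : Real.cos (2 * Real.pi * (x - m)) = Real.cos (2 * Real.pi * x) := by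
    rw [← Real.cos_sub_int_mul_two_pi (2 * Real.pi * x) m]; congr 1; ring
  rw [e] at h
  linarith

/-- Order of vanishing of `√(2U)` at the lattice of zeros of the potential. -/
lemma sqrt_shiftedPotential_le_dist {γ : ℝ} (hγ : 0 ≤ γ) (z x y : ℝ) (m n : ℤ) :
    Real.sqrt (2 * shiftedPotential γ z x y) ≤
      Real.sqrt 2 * (2 * Real.pi ^ 2) ^ (γ / 2) * ((x - z - m) ^ 2 + (y - z - n) ^ 2) ^ (γ / 2) := by
  rw [Real.sqrt_mul (by norm_num), mul_assoc, ← Real.mul_rpow (by positivity) (by positivity)]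
  gcongr
  rw [shiftedPotential, Real.sqrt_eq_rpow, ← Real.rpow_mul (two_sub_cos_nonneg _ _),
    mul_one_div]
  refine Real.rpow_le_rpow (two_sub_cos_nonneg _ _) ?_ (by linarith)
  have h1 := one_sub_cos_le (x - z) m
  have h2 := one_sub_cos_le (y - z) n
  linarith

/-- Writing the cosine as the real part of the first Fourier character descends the function to the
torus, where density of trigonometric polynomials applies. -/
lemma exists_torus_lift_sqrt_shiftedPotential {γ : ℝ} (hγ : 0 ≤ γ) (z : ℝ) :
    ∃ F : C(UnitAddTorus (Fin 2), ℂ), ∀ x y,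
      F (torusPoint x y) = (Real.sqrt (2 * shiftedPotential γ z x y) : ℝ) := by
  have hcos : ∀ x : ℝ, (fourier 1 ((x : UnitAddCircle) - (z : UnitAddCircle)) : ℂ).re =
      Real.cos (2 * Real.pi * (x - z)) := fun x => by
    rw [← AddCircle.coe_sub, fourier_coe_apply]
    rw [← Complex.exp_ofReal_mul_I_re]
    congr 2
    push_cast
    ring
  have hc : Continuous fun t : UnitAddTorus (Fin 2) =>
      (2 - (fourier 1 (t 0 - (z : UnitAddCircle)) : ℂ).re -
        (fourier 1 (t 1 - (z : UnitAddCircle)) : ℂ).re) ^ γ := by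
    refine Continuous.rpow_const ?_ fun _ => Or.inr hγ
    have := Complex.continuous_re
    fun_prop
  refine ⟨⟨fun t => (Real.sqrt (2 * (2 - (fourier 1 (t 0 - (z : UnitAddCircle)) : ℂ).re -
    (fourier 1 (t 1 - (z : UnitAddCircle)) : ℂ).re) ^ γ) : ℝ), ?_⟩, fun x y => ?_⟩
  · exact Complex.continuous_ofReal.comp (Real.continuous_sqrt.comp (continuous_const.mul hc))
  · simp only [ContinuousMap.coe_mk, torusPoint, Matrix.cons_val_zero, Matrix.cons_val_one, hcos,
      shiftedPotential]

lemma effHamiltonian_shiftedPotential_nonpos {γ : ℝ} (hγ : 0 ≤ γ) (z : ℝ) {ξ₁ ξ₂ σ : ℝ}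
    (hξ : HasDiophantineIndex ξ₁ ξ₂ σ) :
    effHamiltonian (mechHamiltonian (shiftedPotential γ z) ξ₁ ξ₂)
      (criticalMomentum (shiftedPotential γ z)) ≤ 0 := by
  obtain ⟨F, hF⟩ := exists_torus_lift_sqrt_shiftedPotential hγ z
  exact effHamiltonian_nonpos (shiftedPotential_nonneg γ z) (sqrt_shiftedPotential_le hγ z)
    fun ε hε => exists_approx_boundedPrimitive (fun k l => hξ.eq_zero_of_resonance) hF hε

/-! ### Displacement of characteristics -/

/-- Displacement bound for characteristics at the critical momentum, uniform in the starting
point. -/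
lemma exists_abs_sub_le_of_isCharacteristic {γ : ℝ} (hγ : 2 < γ) (z : ℝ) {ξ₁ ξ₂ σ : ℝ}
    (hσ : σ < 2) (hξ : HasDiophantineIndex ξ₁ ξ₂ σ) :
    ∃ C : ℝ, 0 < C ∧ ∀ η : ℝ → ℝ,
      IsCharacteristic (mechHamiltonian (shiftedPotential γ z) ξ₁ ξ₂)
        (criticalMomentum (shiftedPotential γ z)) η →
      ∀ t : ℝ, 0 < t → |η t - η 0| ≤ C * t ^ (1 - improvedRate γ) := by
  have hγ0 : 0 ≤ γ := by linarith
  have hξ0 := hξ.fst_ne_zero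
  have hξa : 0 < |ξ₁| := abs_pos.2 hξ0
  set F : ℝ → ℝ := fun u => Real.sqrt (2 * shiftedPotential γ z u (ξ₂ / ξ₁ * u))
  have hFc : Continuous F := Real.continuous_sqrt.comp (continuous_const.mul
    (continuous_shiftedPotential hγ0 z continuous_id (continuous_const.mul continuous_id)))
  obtain ⟨c, hc, hI⟩ := exists_rpow_le_integral_inv hξ hσ hγ.le (z := z)
    (K := Real.sqrt 2 * (2 * Real.pi ^ 2) ^ (γ / 2)) (by positivity) hFc
    (fun u => Real.sqrt_nonneg _) fun u m n => sqrt_shiftedPotential_le_dist hγ0 z u _ m n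
  set B := Real.sqrt (2 * 4 ^ γ)
  have hB : 0 ≤ B := Real.sqrt_nonneg _
  refine ⟨(B + 1) + (4 + (|ξ₁| / c) ^ (2 / γ)) / |ξ₁|, by positivity, fun η hη t ht => ?_⟩
  have hAC : AbsolutelyContinuousOnInterval η 0 t := by
    obtain ⟨v, -, hv⟩ := hη
    exact (hv 0 t le_rfl ht.le).1
  have hsp := hη.ae_abs_deriv_le (effHamiltonian_shiftedPotential_nonpos hγ0 z hξ) ht.le
  have hα : ∀ x, ξ₂ * x = ξ₂ / ξ₁ * (ξ₁ * x) := fun x => by field_simp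
  have hpos : 0 ≤ (4 + (|ξ₁| / c) ^ (2 / γ)) / |ξ₁| := by positivity
  rcases le_total t 1 with ht1 | ht1
  · have h1 := abs_integral_inv_le_of_speed_le (f := fun _ => B) continuous_const (fun _ => hB)
      one_pos ht.le hAC (by
        filter_upwards [hsp] with s hs hst
        exact ⟨(hs hst).1, (hs hst).2.trans (sqrt_shiftedPotential_le hγ0 z _ _)⟩)
    rw [intervalIntegral.integral_const, smul_eq_mul, abs_mul,
      abs_of_pos (by positivity : 0 < 1 / (B + 1)), mul_one_div, div_le_iff₀ (by positivity)] at h1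
    have h2 : t ≤ t ^ (1 - improvedRate γ) := by
      conv_lhs => rw [← Real.rpow_one t]
      exact Real.rpow_le_rpow_of_exponent_ge ht ht1 (by linarith [improvedRate_pos hγ])
    have h3 : 0 ≤ t ^ (1 - improvedRate γ) := by positivity
    nlinarith
  · set f : ℝ → ℝ := fun x => F (ξ₁ * x)
    have hfc : Continuous f := hFc.comp (continuous_const.mul continuous_id)
    have hsp' : ∀ᵐ s, s ∈ Set.uIcc 0 t → DifferentiableAt ℝ η s ∧ |deriv η s| ≤ f (η s) := by
      filter_upwards [hsp] with s hs hst
      rw [hα] at hs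
      exact hs hst
    have hY : |ξ₁| * |η t - η 0| ≤ 4 + (|ξ₁| * t / c) ^ (2 / γ) := by
      rcases le_total (|ξ₁| * |η t - η 0|) 4 with h4 | h4
      · have : 0 ≤ (|ξ₁| * t / c) ^ (2 / γ) := by positivity
        linarith
      set Y := |ξ₁| * |η t - η 0| with hYdef
      -- The left end of the traversed u-interval is taken as a minimum, since both the direction of
      -- motion and the sign of ξ₁ are unknown.
      obtain ⟨ε, hε, hle⟩ := hI Y h4 (min (ξ₁ * η 0) (ξ₁ * η t))
      have h1 := abs_integral_inv_le_of_speed_le hfc (fun _ => Real.sqrt_nonneg _) hε ht.le hAC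
        hsp'
      have h2 : ξ₁ * ∫ x in (η 0)..(η t), 1 / (f x + ε) =
          ∫ u in (ξ₁ * η 0)..(ξ₁ * η t), 1 / (F u + ε) :=
        intervalIntegral.mul_integral_comp_mul_left (f := fun u => 1 / (F u + ε)) ξ₁
      have h3 : |∫ u in (ξ₁ * η 0)..(ξ₁ * η t), 1 / (F u + ε)| ≤ |ξ₁| * t := by
        rw [← h2, abs_mul]; gcongr
      have hYe : Y = |ξ₁ * η t - ξ₁ * η 0| := by rw [hYdef, ← abs_mul, mul_sub]
      have h4' : |∫ u in (ξ₁ * η 0)..(ξ₁ * η t), 1 / (F u + ε)| =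
          |∫ u in (min (ξ₁ * η 0) (ξ₁ * η t))..(min (ξ₁ * η 0) (ξ₁ * η t) + Y),
            1 / (F u + ε)| := by
        rcases le_total (ξ₁ * η 0) (ξ₁ * η t) with h | h
        · rw [min_eq_left h, hYe, abs_of_nonneg (sub_nonneg.2 h), add_sub_cancel]
        · rw [min_eq_right h, hYe, abs_of_nonpos (sub_nonpos.2 h), neg_sub, add_sub_cancel,
            intervalIntegral.integral_symm, abs_neg]
      have h5 : c * Y ^ (γ / 2) ≤ |ξ₁| * t :=
        (hle.trans (le_abs_self _)).trans (h4'.symm.trans_le h3)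
      have hY0 : 0 ≤ Y := by linarith
      have h6 : Y ^ (γ / 2) ≤ |ξ₁| * t / c := by
        rw [le_div_iff₀ hc]; linarith
      have h7 := Real.rpow_le_rpow (by positivity) h6 (by positivity : 0 ≤ 2 / γ)
      rw [← Real.rpow_mul hY0, show γ / 2 * (2 / γ) = 1 by field_simp, Real.rpow_one] at h7
      linarith
    have h8 : (|ξ₁| * t / c) ^ (2 / γ) ≤ (|ξ₁| / c) ^ (2 / γ) * t ^ (1 - improvedRate γ) := by
      rw [mul_div_right_comm, Real.mul_rpow (by positivity) ht.le]
      refine mul_le_mul_of_nonneg_left ?_ (by positivity)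
      exact Real.rpow_le_rpow_of_exponent_le ht1 (two_div_le_one_sub_improvedRate hγ)
    have h9 : 1 ≤ t ^ (1 - improvedRate γ) :=
      Real.one_le_rpow ht1 (le_trans (by positivity) (two_div_le_one_sub_improvedRate hγ))
    have h10 : |η t - η 0| ≤ (4 + (|ξ₁| / c) ^ (2 / γ)) / |ξ₁| * t ^ (1 - improvedRate γ) := by
      rw [div_mul_eq_mul_div, le_div_iff₀ hξa]
      linarith
    have h11 : 0 ≤ (B + 1) * t ^ (1 - improvedRate γ) := by positivity
    rw [add_mul]
    linarith

/-- The averaged displacement estimate for the translated prototype. -/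
lemma exists_abs_div_le_of_isCharacteristic {γ : ℝ} (hγ : 2 < γ) (z : ℝ) {ξ₁ ξ₂ σ : ℝ}
    (hσ : σ < 2) (hξ : HasDiophantineIndex ξ₁ ξ₂ σ) :
    ∃ C : ℝ, 0 < C ∧ ∀ η : ℝ → ℝ,
      IsCharacteristic (mechHamiltonian (shiftedPotential γ z) ξ₁ ξ₂)
        (criticalMomentum (shiftedPotential γ z)) η →
        (η 0 = 0 → ∀ t : ℝ, 0 < t → |η t / t| ≤ C * t ^ (-improvedRate γ)) ∧
        (∀ t : ℝ, 1 ≤ t → |η t / t| ≤ (C + |η 0|) * t ^ (-improvedRate γ)) := by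
  obtain ⟨C, hC, h⟩ := exists_abs_sub_le_of_isCharacteristic hγ z hσ hξ
  have hdiv : ∀ {t a A : ℝ}, 0 < t → |a| ≤ A * t ^ (1 - improvedRate γ) →
      |a / t| ≤ A * t ^ (-improvedRate γ) := by
    intro t a A ht ha
    rw [abs_div, abs_of_pos ht, div_le_iff₀ ht, mul_assoc, ← Real.rpow_add_one ht.ne']
    rwa [neg_add_eq_sub]
  refine ⟨C, hC, fun η hη => ⟨fun h0 t ht => hdiv ht ?_, fun t ht => ?_⟩⟩
  · simpa [h0] using h η hη t ht
  · have ht0 : 0 < t := by linarith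
    refine hdiv ht0 ?_
    -- For t ≥ 1 this factor absorbs the starting point |η 0|.
    have h1 : 1 ≤ t ^ (1 - improvedRate γ) := Real.one_le_rpow ht
      (le_trans (by positivity) (two_div_le_one_sub_improvedRate hγ))
    have h2 := h η hη t ht0
    have h3 := abs_sub_abs_le_abs_sub (η t) (η 0)
    nlinarith [abs_nonneg (η 0)]

end QPHomog

theorem mainTheorem11 (γ : ℝ) (hγ : 2 < γ) (ξ₁ ξ₂ σ : ℝ) (hσ : σ < 2)
    (hξ : QPHomog.HasDiophantineIndex ξ₁ ξ₂ σ) (U : ℝ → ℝ → ℝ)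
    (hU : U = QPHomog.sinPotential γ ∨ U = QPHomog.cosPotential γ) :
    (γ - 2) / (3 * γ - 2) < QPHomog.improvedRate γ ∧
    ∃ C : ℝ, 0 < C ∧ ∀ η : ℝ → ℝ,
      QPHomog.IsCharacteristic (QPHomog.mechHamiltonian U ξ₁ ξ₂) (QPHomog.criticalMomentum U) η →
        (η 0 = 0 → ∀ t : ℝ, 0 < t → |η t / t| ≤ C * t ^ (-QPHomog.improvedRate γ)) ∧
        (∀ t : ℝ, 1 ≤ t → |η t / t| ≤ (C + |η 0|) * t ^ (-QPHomog.improvedRate γ)) := by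
  refine ⟨QPHomog.lt_improvedRate hγ, ?_⟩
  rcases hU with rfl | rfl
  · rw [QPHomog.sinPotential_eq]
    exact QPHomog.exists_abs_div_le_of_isCharacteristic hγ _ hσ hξ
  · rw [QPHomog.cosPotential_eq]
    exact QPHomog.exists_abs_div_le_of_isCharacteristic hγ _ hσ hξ
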